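/- Let $d \ge 2$ and let $(S_k)_{k\ge 0}$ be the simple random walk on $\mathbb{Z}^d$, with law $P^x$ and expectation $E^x$ when it starts at $x\in\mathbb{Z}^d$. Let $\omega=(\omega(z))_{z\in\mathbb{Z}^d}$ be an i.i.d. family of $[0,\infty)$-valued random variables that are not almost surely $0$, with law $\mathbb{P}$ (the product measure on $[0,\infty)^{\mathbb{Z}^d}$) and expectation $\mathbb{E}$. For $y\in\mathbb{Z}^d$ put $H(y)=\inf\{k\ge 0 : S_k=y\}$, and define the travel cost from $x$ to $y$ by $$a(x,y)=a(x,y,\omega)=-\log E^x\Bigl[\exp\Bigl\{-\sum_{k=0}^{H(y)-1}\omega(S_k)\Bigr\}\mathbf 1_{\{H(y)<\infty\}}\Bigr].$$ Assume (A1) $\mathbb{E}[e^{\gamma\omega(0)}]<\infty$ for some $\gamma>0$. Then for every $x\in\mathbb{Z}^d$ the variables $a(0,nx)$, $n\ge 0$, are $\mathbb{P}$-integrable, and the Lyapunov exponent $$\alpha(x)=\inf_{n\ge1}\frac1n\,\mathbb{E}[a(0,nx)]=\lim_{n\to\infty}\frac1n\,\mathbb{E}[a(0,nx)]$$ is well defined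 (the limit exists and equals the infimum). Moreover, for every $\varepsilon>0$ there exist constants $0<C,c<\infty$ such that for all $x\in\mathbb{Z}^d$, $$\mathbb{P}\bigl(a(0,x)-\alpha(x)\ge\varepsilon\|x\|_1\bigr)\le C\,e^{-c\|x\|_1},$$ where $\|\cdot\|_1$ is the $\ell^1$-norm. -/

import Mathlib

open MeasureTheory ProbabilityTheory Filter Topology
open scoped NNReal

noncomputable section

namespace RWPotential

/-- The cubic lattice `ℤ^d`. -/
abbrev Site (d : ℕ) : Type := Fin d → ℤ

/-- The `ℓ¹`-norm of a lattice point, as a real number. -/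
def l1norm {d : ℕ} (x : Site d) : ℝ := ∑ i, |(x i : ℝ)|

/-- The `2d` unit vectors `± e_i`, indexed by a direction and a sign. -/
def unitStep {d : ℕ} (s : Fin d × Bool) : Site d :=
  Pi.single s.1 (if s.2 then 1 else -1)

instance isProbabilityMeasure_uniformStep (d : ℕ) [NeZero d] :
    IsProbabilityMeasure (uniformOn (Set.univ : Set (Fin d × Bool))) :=
  isProbabilityMeasure_uniformOn Set.finite_univ Set.univ_nonempty

/-- The law of the i.i.d. sequence of uniformly chosen steps that drives the walk. -/
def stepLaw (d : ℕ) [NeZero d] : Measure (ℕ → Fin d × Bool) :=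
  Measure.infinitePi fun _ : ℕ => uniformOn (Set.univ : Set (Fin d × Bool))

/-- The trajectory `S_k = x + ξ_0 + ⋯ + ξ_{k-1}` that starts at `x` and follows the steps `ξ`. -/
def trajectory {d : ℕ} (x : Site d) (ξ : ℕ → Fin d × Bool) : ℕ → Site d :=
  fun k => x + ∑ j ∈ Finset.range k, unitStep (ξ j)

/-- `P^x`: the law, on the space of trajectories, of the simple random walk started at `x`. -/
def walkLaw {d : ℕ} [NeZero d] (x : Site d) : Measure (ℕ → Site d) :=
  (stepLaw d).map (trajectory x)

/-- `H(y) = inf {k ≥ 0 : S_k = y}`, with value `⊤` if the trajectory never visits `y`. -/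
def hitTime {d : ℕ} (y : Site d) (S : ℕ → Site d) : WithTop ℕ :=
  hittingAfter (fun (k : ℕ) (T : ℕ → Site d) => T k) {y} 0 S

/-- `e(x, y, ω) = E^x[exp(-∑_{k=0}^{H(y)-1} ω(S_k)) 1{H(y) < ∞}]`. -/
def travelWeight {d : ℕ} [NeZero d] (x y : Site d) (ω : Site d → ℝ≥0) : ℝ :=
  ∫ S, Set.indicator {T : ℕ → Site d | hitTime y T < ⊤}
    (fun T => Real.exp (-∑ k ∈ Finset.range ((hitTime y T).untopD 0), (ω (T k) : ℝ))) S
    ∂(walkLaw x)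

/-- The travel cost `a(x, y, ω) = -log e(x, y, ω)`. -/
def travelCost {d : ℕ} [NeZero d] (x y : Site d) (ω : Site d → ℝ≥0) : ℝ :=
  -Real.log (travelWeight x y ω)

/-- The law `ℙ` of the i.i.d. potential on `[0,∞)^{ℤ^d}` whose value at each site has law `ρ`. -/
def potentialLaw (d : ℕ) (ρ : Measure ℝ≥0) [IsProbabilityMeasure ρ] :
    Measure (Site d → ℝ≥0) :=
  Measure.infinitePi fun _ : Site d => ρ

/-- The Lyapunov exponent at lattice points: `α(x) = inf_{n ≥ 1} 𝔼[a(0, n x)] / n`. -/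
def lyapunov (d : ℕ) [NeZero d] (ρ : Measure ℝ≥0) [IsProbabilityMeasure ρ] (x : Site d) : ℝ :=
  ⨅ n : ℕ+, (∫ ω, travelCost 0 ((n : ℕ) • x) ω ∂(potentialLaw d ρ)) / (n : ℝ)

end RWPotential

end

namespace RWPotential

/-! The travel cost obeys the triangle inequality and its law is shift invariant, so the means of
`a(0,nx)` are subadditive in `n` and Fekete's lemma identifies the limit with the infimum. Forcing
the walk along a shortest path bounds `a(x,y)` by a sum of i.i.d. terms `ω z + log (2d)`, one for
each of the `‖y - x‖₁` sites visited before `y`. This gives integrability, and by (A1) exponential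
moments.

For the tail in a fixed direction `v`, choose `N` with mean cost to `N • v` below `N (α(v) + ε/2)`.
Allowing only paths of at most `n` steps, `n` large, keeps the mean below this level and makes the
cost depend on a finite ball of the potential. The truncated costs of successive blocks `jNv →
(j+1)Nv` then split into `2n + 1` residue classes of independent variables, and Chernoff's bound
applies to each class (`measure_sum_truncCost_ge_le`, `exists_measure_travelCost_nsmul_le`).

For uniformity in `x`, approximate `x` by `k • v` with `k` about `‖x‖₁ / M` and `v` in a finite set
depending on `M` only (`exists_nsmul_near`). The leftover distance is at most `d k ≤ d ‖x‖₁ / M`, so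
for `M` large its cost is absorbed in `ε ‖x‖₁`.

Everything about the walk passes through `truncWeight`, a recursion on the number of steps whose
increasing limit is `travelWeight` (`tendsto_truncWeight`); the inequalities are proved there by
induction. -/

/-- The contribution of a trajectory to the weight of the paths that reach `y` within `n` steps. -/
noncomputable def truncGain {d : ℕ} (ω : Site d → ℝ≥0) (y : Site d) : ℕ → (ℕ → Site d) → ℝ
  | 0, T => if T 0 = y then 1 else 0
  | n + 1, T => if T 0 = y then 1 else Real.exp (-(ω (T 0) : ℝ)) * truncGain ω y n fun k => T (k + 1)

/-- The travel weight from `x` to `y` restricted to the paths that reach `y` within `n` steps. -/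
noncomputable def truncWeight {d : ℕ} (ω : Site d → ℝ≥0) (y : Site d) : ℕ → Site d → ℝ
  | 0, x => if x = y then 1 else 0
  | n + 1, x => if x = y then 1 else
      Real.exp (-(ω x : ℝ)) * ((2 * d : ℝ)⁻¹ * ∑ s, truncWeight ω y n (x + unitStep s))

variable {d : ℕ}

/-! ### From the walk measure to the first-step recursion. -/

section Trajectories

lemma truncGain_of_hit (ω : Site d → ℝ≥0) (y : Site d) {n h : ℕ} {T : ℕ → Site d} (hn : h ≤ n)
    (hy : T h = y) (hlt : ∀ k < h, T k ≠ y) :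
    truncGain ω y n T = Real.exp (-∑ k ∈ Finset.range h, (ω (T k) : ℝ)) := by
  induction n generalizing h T with
  | zero =>
    obtain rfl : h = 0 := by omega
    simp [truncGain, hy]
  | succ n ih =>
    rcases h with _ | h
    · simp [truncGain, hy]
    · rw [truncGain, if_neg (hlt 0 (by omega)),
        ih (h := h) (T := fun k => T (k + 1)) (by omega) hy fun k hk => hlt _ (by omega),
        ← Real.exp_add, Finset.sum_range_succ']
      congr 1
      ring

lemma truncGain_of_not_hit (ω : Site d → ℝ≥0) (y : Site d) {n : ℕ} {T : ℕ → Site d}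
    (hlt : ∀ k ≤ n, T k ≠ y) : truncGain ω y n T = 0 := by
  induction n generalizing T with
  | zero => simp [truncGain, hlt 0 le_rfl]
  | succ n ih =>
    rw [truncGain, if_neg (hlt 0 (by omega)),
      ih (T := fun k => T (k + 1)) fun k hk => hlt _ (by omega), mul_zero]

lemma truncGain_nonneg (ω : Site d → ℝ≥0) (y : Site d) (n : ℕ) (T : ℕ → Site d) :
    0 ≤ truncGain ω y n T := by
  induction n generalizing T with
  | zero => rw [truncGain]; split_ifs <;> norm_num
  | succ n ih =>
    rw [truncGain]
    split_ifs
    · norm_num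
    · exact mul_nonneg (Real.exp_pos _).le (ih _)

lemma truncGain_le_one (ω : Site d → ℝ≥0) (y : Site d) (n : ℕ) (T : ℕ → Site d) :
    truncGain ω y n T ≤ 1 := by
  induction n generalizing T with
  | zero => rw [truncGain]; split_ifs <;> norm_num
  | succ n ih =>
    rw [truncGain]
    split_ifs
    · norm_num
    · exact mul_le_one₀ (Real.exp_le_one_iff.2 (by simp)) (truncGain_nonneg _ _ _ _) (ih _)

lemma measurable_truncGain (ω : Site d → ℝ≥0) (y : Site d) (n : ℕ) :
    Measurable (truncGain ω y n) := by
  have h0 : MeasurableSet {T : ℕ → Site d | T 0 = y} :=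
    measurableSet_eq_fun (measurable_pi_apply 0) measurable_const
  induction n with
  | zero => exact Measurable.ite h0 measurable_const measurable_const
  | succ n ih =>
    refine Measurable.ite h0 measurable_const (Measurable.mul ?_ (ih.comp ?_))
    · exact (measurable_of_countable fun z : Site d => Real.exp (-(ω z : ℝ))).comp
        (measurable_pi_apply 0)
    · exact measurable_pi_lambda _ fun k => measurable_pi_apply (k + 1)

/-- The integrand in the definition of the travel weight. -/
noncomputable def gain (ω : Site d → ℝ≥0) (y : Site d) : (ℕ → Site d) → ℝ :=
  Set.indicator {T : ℕ → Site d | hitTime y T < ⊤}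
    (fun T => Real.exp (-∑ k ∈ Finset.range ((hitTime y T).untopD 0), (ω (T k) : ℝ)))

/-- For each trajectory the sequence is constant from the hitting time on, or identically zero. The
limit yields both the measurability of `gain` and, by dominated convergence, the convergence of the
weights. -/
lemma tendsto_truncGain (ω : Site d → ℝ≥0) (y : Site d) (T : ℕ → Site d) :
    Tendsto (fun n => truncGain ω y n T) atTop (𝓝 (gain ω y T)) := by
  classical
  by_cases h : ∃ j, T j = y
  · have hfind : hitTime y T = ((Nat.find h : ℕ) : WithTop ℕ) := by
      have h' : ∃ j, 0 ≤ j ∧ T j ∈ ({y} : Set (Site d)) := by simpa using h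
      rw [hitTime, hittingAfter_def]
      simp only [if_pos h']
      congr 1
      rw [Nat.sInf_def (by simpa [Set.Nonempty] using h)]
      congr 1
      ext
      simp
    have : gain ω y T = Real.exp (-∑ k ∈ Finset.range (Nat.find h), (ω (T k) : ℝ)) := by
      rw [gain, Set.indicator_of_mem (by simp [hfind]), hfind]
      rfl
    rw [this]
    refine tendsto_const_nhds.congr' ?_
    filter_upwards [eventually_ge_atTop (Nat.find h)] with n hn
    exact (truncGain_of_hit ω y hn (Nat.find_spec h) fun k hk => Nat.find_min h hk).symm
  · have : gain ω y T = 0 := by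
      refine Set.indicator_of_notMem ?_ _
      simpa [hitTime, hittingAfter_def] using h
    rw [this]
    refine tendsto_const_nhds.congr fun n => ?_
    exact (truncGain_of_not_hit ω y fun k _ hk => h ⟨k, hk⟩).symm

lemma measurable_gain (ω : Site d → ℝ≥0) (y : Site d) : Measurable (gain ω y) :=
  measurable_of_tendsto_metrizable (measurable_truncGain ω y)
    (tendsto_pi_nhds.2 (tendsto_truncGain ω y))

lemma measurable_trajectory (x : Site d) : Measurable (trajectory x) := by
  refine measurable_pi_lambda _ fun k => ?_
  refine measurable_const.add (Finset.measurable_sum _ fun j _ => ?_)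
  exact (measurable_of_countable unitStep).comp (measurable_pi_apply j)

/-- Prepending an element to a sequence. -/
def prepend {α : Type*} (p : α × (ℕ → α)) : ℕ → α
  | 0 => p.1
  | n + 1 => p.2 n

lemma measurable_prepend {α : Type*} [MeasurableSpace α] :
    Measurable (prepend : α × (ℕ → α) → ℕ → α) := by
  refine measurable_pi_lambda _ fun k => ?_
  cases k with
  | zero => exact measurable_fst
  | succ n => exact (measurable_pi_apply n).comp measurable_snd

/-- This is the Markov property at time 1 at the level of steps: splitting off the first of i.i.d.
steps leaves an independent sequence of the same law. -/
lemma map_prepend_infinitePi {α : Type*} [MeasurableSpace α] (μ : Measure α)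
    [IsProbabilityMeasure μ] :
    (μ.prod (Measure.infinitePi fun _ : ℕ => μ)).map prepend = Measure.infinitePi fun _ : ℕ => μ := by
  refine Measure.eq_infinitePi _ fun s t ht => ?_
  rw [Measure.map_apply measurable_prepend (.pi s.countable_toSet fun _ _ => ht _)]
  have hsucc : Function.Injective Nat.succ := Nat.succ_injective
  have hpre : prepend ⁻¹' (Set.pi (s : Set ℕ) t) =
      (if 0 ∈ s then t 0 else Set.univ) ×ˢ
        Set.pi (s.preimage Nat.succ hsucc.injOn : Set ℕ) (fun n => t (n + 1)) := by
    ext ⟨a, ξ⟩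
    simp only [Set.mem_preimage, Set.mem_pi, Finset.mem_coe, Set.mem_prod, Finset.mem_preimage]
    constructor
    · intro h
      refine ⟨?_, fun n hn => h (n + 1) hn⟩
      split_ifs with h0
      · exact h 0 h0
      · trivial
    · rintro ⟨h0, h1⟩ (_ | n) hn
      · simpa [hn, prepend] using h0
      · exact h1 n hn
  rw [hpre, Measure.prod_prod, Measure.infinitePi_pi _ fun i _ => ht (i + 1)]
  -- Index 0 is given the factor 1, so that the product over the shifted index set extends to all of
  -- `s`.
  have hprod := Finset.prod_preimage Nat.succ s hsucc.injOn (fun i => if i = 0 then 1 else μ (t i))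
    (fun i _ hi => by cases i with
      | zero => simp
      | succ n => exact absurd ⟨n, rfl⟩ hi)
  simp only [Nat.succ_eq_add_one, Nat.add_eq_zero_iff, one_ne_zero, and_false, if_false] at hprod
  rw [hprod]
  split_ifs with h0
  · rw [← Finset.mul_prod_erase s (fun i => μ (t i)) h0,
      ← Finset.mul_prod_erase s (fun i => if i = 0 then 1 else μ (t i)) h0]
    simp only [if_true, one_mul]
    congr 1
    exact Finset.prod_congr rfl fun i hi => by simp [(Finset.mem_erase.1 hi).1]
  · rw [measure_univ, one_mul]
    exact Finset.prod_congr rfl fun i hi => by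
      rw [if_neg]
      rintro rfl
      exact h0 hi

lemma trajectory_zero (x : Site d) (ξ : ℕ → Fin d × Bool) : trajectory x ξ 0 = x := by
  simp [trajectory]

lemma trajectory_prepend (x : Site d) (s : Fin d × Bool) (ξ : ℕ → Fin d × Bool) :
    (fun k => trajectory x (prepend (s, ξ)) (k + 1)) = trajectory (x + unitStep s) ξ := by
  funext k
  simp only [trajectory, Finset.sum_range_succ', prepend]
  abel

lemma integral_uniformOn_univ [NeZero d] (f : Fin d × Bool → ℝ) :
    ∫ s, f s ∂(uniformOn (Set.univ : Set (Fin d × Bool))) = (2 * d : ℝ)⁻¹ * ∑ s, f s := by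
  rw [integral_fintype (Integrable.of_finite), Finset.mul_sum]
  refine Finset.sum_congr rfl fun s _ => ?_
  rw [Measure.real, uniformOn_univ]
  simp [mul_comm]

variable [NeZero d]

lemma integral_truncGain (ω : Site d → ℝ≥0) (y : Site d) (n : ℕ) (x : Site d) :
    ∫ ξ, truncGain ω y n (trajectory x ξ) ∂(stepLaw d) = truncWeight ω y n x := by
  have : IsProbabilityMeasure (stepLaw d) := by unfold stepLaw; infer_instance
  induction n generalizing x with
  | zero => simp [truncGain, truncWeight, trajectory_zero]
  | succ n ih =>
    simp only [truncGain, truncWeight, trajectory_zero]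
    split_ifs with hxy
    · simp
    rw [integral_const_mul]
    congr 1
    have hmeas : Measurable fun ξ : ℕ → Fin d × Bool =>
        truncGain ω y n fun k => trajectory x ξ (k + 1) := by
      refine (measurable_truncGain ω y n).comp (measurable_pi_lambda _ fun k => ?_)
      exact (measurable_pi_apply (k + 1)).comp (measurable_trajectory x)
    conv_lhs => rw [stepLaw, ← map_prepend_infinitePi]
    rw [integral_map measurable_prepend.aemeasurable hmeas.aestronglyMeasurable,
      integral_prod]
    · simp only [trajectory_prepend]
      rw [← integral_uniformOn_univ]
      exact integral_congr_ae (.of_forall fun s => ih _)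
    · refine Integrable.of_bound (hmeas.comp measurable_prepend).aestronglyMeasurable 1
        (.of_forall fun p => ?_)
      rw [Real.norm_of_nonneg (truncGain_nonneg _ _ _ _)]
      exact truncGain_le_one _ _ _ _

lemma tendsto_truncWeight (ω : Site d → ℝ≥0) (x y : Site d) :
    Tendsto (fun n => truncWeight ω y n x) atTop (𝓝 (travelWeight x y ω)) := by
  have : IsProbabilityMeasure (stepLaw d) := by unfold stepLaw; infer_instance
  have h : travelWeight x y ω = ∫ ξ, gain ω y (trajectory x ξ) ∂(stepLaw d) := by
    rw [← integral_map (measurable_trajectory x).aemeasurable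
      (measurable_gain ω y).aestronglyMeasurable]
    rfl
  simp only [h, ← integral_truncGain]
  refine tendsto_integral_of_dominated_convergence (fun _ => 1) (fun n => ?_)
    (integrable_const 1) (fun n => .of_forall fun ξ => ?_)
    (.of_forall fun ξ => tendsto_truncGain ω y _)
  · exact ((measurable_truncGain ω y n).comp (measurable_trajectory x)).aestronglyMeasurable
  · rw [Real.norm_of_nonneg (truncGain_nonneg _ _ _ _)]
    exact truncGain_le_one _ _ _ _

end Trajectories

end RWPotential

namespace RWPotential

/-- The `ℓ¹`-norm of a lattice point, as a natural number. -/
def siteNorm {d : ℕ} (x : Site d) : ℕ := ∑ i, (x i).natAbs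

variable {d : ℕ}

/-! ### Geometry of the `ℓ¹`-norm on the lattice. -/

section SiteNorm

lemma l1norm_eq_siteNorm (x : Site d) : l1norm x = siteNorm x := by
  simp [l1norm, siteNorm, Nat.cast_natAbs]

@[simp] lemma siteNorm_zero : siteNorm (0 : Site d) = 0 := by simp [siteNorm]

lemma siteNorm_eq_zero {x : Site d} : siteNorm x = 0 ↔ x = 0 := by
  simp [siteNorm, funext_iff]

lemma siteNorm_add_le (x y : Site d) : siteNorm (x + y) ≤ siteNorm x + siteNorm y := by
  rw [siteNorm, siteNorm, siteNorm, ← Finset.sum_add_distrib]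
  exact Finset.sum_le_sum fun i _ => Int.natAbs_add_le _ _

lemma siteNorm_neg (x : Site d) : siteNorm (-x) = siteNorm x := by simp [siteNorm]

lemma siteNorm_nsmul (n : ℕ) (x : Site d) : siteNorm (n • x) = n * siteNorm x := by
  simp [siteNorm, Finset.mul_sum, Int.natAbs_mul]

lemma siteNorm_unitStep (s : Fin d × Bool) : siteNorm (unitStep s) = 1 := by
  rw [siteNorm, Finset.sum_eq_single s.1]
  · simp only [unitStep, Pi.single_eq_same]
    split_ifs <;> rfl
  · intro i _ hi
    simp [unitStep, hi]
  · simp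

lemma natAbs_le_siteNorm (x : Site d) (i : Fin d) : (x i).natAbs ≤ siteNorm x :=
  Finset.single_le_sum (f := fun i => (x i).natAbs) (fun _ _ => Nat.zero_le _) (Finset.mem_univ i)

lemma exists_siteNorm_sub_unitStep {x : Site d} {m : ℕ} (hx : siteNorm x = m + 1) :
    ∃ s, siteNorm (x - unitStep s) = m := by
  obtain ⟨i, hi⟩ : ∃ i, x i ≠ 0 := by
    by_contra! h
    have : x = 0 := funext h
    simp [this] at hx
  refine ⟨(i, decide (0 < x i)), ?_⟩
  have h1 := Finset.add_sum_erase Finset.univ (fun j => (x j).natAbs) (Finset.mem_univ i)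
  have h2 := Finset.add_sum_erase Finset.univ
    (fun j => ((x - unitStep (i, decide (0 < x i))) j).natAbs) (Finset.mem_univ i)
  have h3 : ∑ j ∈ Finset.univ.erase i, ((x - unitStep (i, decide (0 < x i))) j).natAbs =
      ∑ j ∈ Finset.univ.erase i, (x j).natAbs := by
    refine Finset.sum_congr rfl fun j hj => ?_
    simp [unitStep, (Finset.mem_erase.1 hj).1]
  simp only [siteNorm] at hx ⊢
  rw [← h2, h3]
  rw [← h1] at hx
  simp only [unitStep, Pi.sub_apply, Pi.single_eq_same, decide_eq_true_eq]
  split_ifs <;> omega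

lemma finite_siteNorm_le (m : ℕ) : {x : Site d | siteNorm x ≤ m}.Finite := by
  refine (Set.finite_Icc (fun _ : Fin d => -(m : ℤ)) fun _ => (m : ℤ)).subset fun x hx => ?_
  have h : ∀ i, (x i).natAbs ≤ m := fun i => (natAbs_le_siteNorm x i).trans hx
  exact ⟨fun i => by have := h i; simp only; omega, fun i => by have := h i; simp only; omega⟩

end SiteNorm

/-! ### Truncated weights: monotonicity, concatenation, locality, lower bound. -/

section TruncWeight

variable (ω : Site d → ℝ≥0)

@[simp] lemma truncWeight_self (y : Site d) (n : ℕ) : truncWeight ω y n y = 1 := by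
  cases n <;> simp [truncWeight]

lemma truncWeight_nonneg (y : Site d) (n : ℕ) (x : Site d) : 0 ≤ truncWeight ω y n x := by
  induction n generalizing x with
  | zero => rw [truncWeight]; split_ifs <;> norm_num
  | succ n ih =>
    rw [truncWeight]
    split_ifs
    · norm_num
    · have := Finset.sum_nonneg fun s (_ : s ∈ Finset.univ) => ih (x + unitStep s)
      positivity

lemma truncWeight_le_succ (y : Site d) (n : ℕ) (x : Site d) :
    truncWeight ω y n x ≤ truncWeight ω y (n + 1) x := by
  induction n generalizing x with
  | zero =>
    by_cases h : x = y
    · simp [h]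
    · exact (if_neg h : truncWeight ω y 0 x = 0).le.trans (truncWeight_nonneg _ _ _ _)
  | succ n ih =>
    by_cases h : x = y
    · simp [h]
    · rw [truncWeight, truncWeight, if_neg h, if_neg h]
      gcongr
      exact ih _

lemma monotone_truncWeight (x y : Site d) : Monotone fun n => truncWeight ω y n x :=
  monotone_nat_of_le_succ fun n => truncWeight_le_succ ω y n x

lemma truncWeight_le_one [NeZero d] (y : Site d) (n : ℕ) (x : Site d) :
    truncWeight ω y n x ≤ 1 := by
  rw [← integral_truncGain]
  have : IsProbabilityMeasure (stepLaw d) := by unfold stepLaw; infer_instance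
  refine (integral_mono_of_nonneg (.of_forall fun _ => truncGain_nonneg _ _ _ _)
    (integrable_const (1 : ℝ)) (.of_forall fun _ => truncGain_le_one _ _ _ _)).trans ?_
  simp

/-- Concatenating a path to `y` with a path from `y` to `z` gives a path to `z`. If `z` is met
before `y`, stopping there only increases the weight, as all weights are at most 1. This is the
source of the triangle inequality. -/
lemma truncWeight_mul_le [NeZero d] (y z : Site d) (n m : ℕ) (x : Site d) :
    truncWeight ω y n x * truncWeight ω z m y ≤ truncWeight ω z (n + m) x := by
  induction n generalizing x with
  | zero =>
    by_cases h : x = y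
    · subst h
      simp
    · simpa [truncWeight, h] using truncWeight_nonneg _ _ _ _
  | succ n ih =>
    by_cases h : x = y
    · subst h
      simpa using monotone_truncWeight ω x z (Nat.le_add_left m (n + 1))
    by_cases hz : x = z
    · subst hz
      simpa using mul_le_one₀ (truncWeight_le_one ω y (n + 1) x) (truncWeight_nonneg _ _ _ _)
        (truncWeight_le_one ω x m y)
    · rw [Nat.add_right_comm, truncWeight, truncWeight, if_neg h, if_neg hz, mul_assoc, mul_assoc,
        Finset.sum_mul]
      gcongr
      exact ih _

lemma truncWeight_add_right (v y : Site d) (n : ℕ) (x : Site d) :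
    truncWeight ω (y + v) n (x + v) = truncWeight (fun z => ω (z + v)) y n x := by
  induction n generalizing x with
  | zero => simp [truncWeight]
  | succ n ih => simp only [truncWeight, add_left_inj, ← ih, add_right_comm]

lemma measurable_truncWeight (y : Site d) (n : ℕ) (x : Site d) :
    Measurable fun ω : Site d → ℝ≥0 => truncWeight ω y n x := by
  induction n generalizing x with
  | zero => simp [truncWeight]
  | succ n ih =>
    simp only [truncWeight]
    split_ifs
    · exact measurable_const
    · have := fun s => ih (x + unitStep s)
      fun_prop

/-- A path of at most `n` steps stays in the ball of radius `n`; this finite range is the reason for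
truncating. -/
lemma truncWeight_congr {ω ω' : Site d → ℝ≥0} (y : Site d) (n : ℕ) (x : Site d)
    (h : ∀ z, siteNorm (z - x) ≤ n → ω z = ω' z) :
    truncWeight ω y n x = truncWeight ω' y n x := by
  induction n generalizing x with
  | zero => simp [truncWeight]
  | succ n ih =>
    simp only [truncWeight]
    rw [h x (by simp)]
    congr 3
    refine Finset.sum_congr rfl fun s _ => ih _ fun z hz => h z ?_
    have := siteNorm_add_le (z - (x + unitStep s)) (unitStep s)
    rw [siteNorm_unitStep, show z - (x + unitStep s) + unitStep s = z - x by abel] at this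
    omega

/-- A finite set of sites, visited by a shortest path, bounds the travel weight from below. -/
lemma exists_path_le_truncWeight [NeZero d] (y : Site d) (m : ℕ) (x : Site d)
    (hm : siteNorm (y - x) = m) :
    ∃ P : Finset (Site d), P.card = m ∧ (∀ z ∈ P, siteNorm (y - z) ≤ m) ∧
      ∀ ω : Site d → ℝ≥0,
        Real.exp (-∑ z ∈ P, ((ω z : ℝ) + Real.log (2 * d))) ≤ truncWeight ω y m x := by
  classical
  induction m generalizing x with
  | zero =>
    have : x = y := by
      rw [siteNorm_eq_zero, sub_eq_zero] at hm
      exact hm.symm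
    exact ⟨∅, by simp, by simp, by simp [this]⟩
  | succ m ih =>
    obtain ⟨s, hs⟩ := exists_siteNorm_sub_unitStep hm
    rw [sub_sub] at hs
    obtain ⟨P, hcard, hP, hle⟩ := ih (x + unitStep s) hs
    -- The sites of `P` are strictly closer to `y` than `x`. Hence no site is counted twice, which
    -- later makes the summands along `P` independent.
    have hx : x ∉ P := fun h => by have := hP x h; omega
    refine ⟨insert x P, by rw [Finset.card_insert_of_notMem hx, hcard], ?_, fun ω => ?_⟩
    · intro z hz
      rcases Finset.mem_insert.1 hz with rfl | hz
      · exact hm.le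
      · exact (hP z hz).trans (Nat.le_succ m)
    · have hxy : x ≠ y := by
        rintro rfl
        simp at hm
      have hd : (0 : ℝ) < 2 * d := by
        have := NeZero.pos d
        positivity
      rw [Finset.sum_insert hx, truncWeight, if_neg hxy, neg_add, neg_add, Real.exp_add,
        Real.exp_add, mul_assoc, Real.exp_neg (Real.log _), Real.exp_log hd]
      gcongr
      exact (hle ω).trans (Finset.single_le_sum (f := fun s => truncWeight ω y m (x + unitStep s))
        (fun _ _ => truncWeight_nonneg _ _ _ _) (Finset.mem_univ s))

end TruncWeight

end RWPotential

namespace RWPotential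

variable {d : ℕ}

/-- The travel cost from `x` to `y` when only paths of at most `n` steps are allowed. -/
noncomputable def truncCost (n : ℕ) (x y : Site d) (ω : Site d → ℝ≥0) : ℝ :=
  -Real.log (truncWeight ω y n x)

/-! ### Travel costs for a fixed potential. -/

section Deterministic

lemma measurable_truncCost (n : ℕ) (x y : Site d) : Measurable (truncCost n x y) :=
  (Real.measurable_log.comp (measurable_truncWeight y n x)).neg

lemma truncCost_add_right (n : ℕ) (x y v : Site d) (ω : Site d → ℝ≥0) :
    truncCost n (x + v) (y + v) ω = truncCost n x y fun z => ω (z + v) := by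
  rw [truncCost, truncCost, truncWeight_add_right]

lemma truncCost_congr {ω ω' : Site d → ℝ≥0} (n : ℕ) (x y : Site d)
    (h : ∀ z, siteNorm (z - x) ≤ n → ω z = ω' z) : truncCost n x y ω = truncCost n x y ω' := by
  rw [truncCost, truncCost, truncWeight_congr y n x h]

variable [NeZero d]

lemma truncWeight_pos (ω : Site d → ℝ≥0) {n : ℕ} {x y : Site d} (h : siteNorm (y - x) ≤ n) :
    0 < truncWeight ω y n x := by
  obtain ⟨P, -, -, hP⟩ := exists_path_le_truncWeight y _ x rfl
  exact (Real.exp_pos _).trans_le ((hP ω).trans (monotone_truncWeight ω x y h))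

lemma truncCost_nonneg (n : ℕ) (x y : Site d) (ω : Site d → ℝ≥0) : 0 ≤ truncCost n x y ω :=
  neg_nonneg.2 (Real.log_nonpos (truncWeight_nonneg _ _ _ _) (truncWeight_le_one _ _ _ _))

/-- A finite set of sites, visited by a shortest path, bounds the truncated costs from above. -/
lemma exists_path_truncCost_le (x y : Site d) :
    ∃ P : Finset (Site d), P.card = siteNorm (y - x) ∧ ∀ n, siteNorm (y - x) ≤ n →
      ∀ ω : Site d → ℝ≥0, truncCost n x y ω ≤ ∑ z ∈ P, ((ω z : ℝ) + Real.log (2 * d)) := by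
  obtain ⟨P, hcard, -, hP⟩ := exists_path_le_truncWeight y _ x rfl
  refine ⟨P, hcard, fun n hn ω => ?_⟩
  rw [truncCost, neg_le, Real.le_log_iff_exp_le (truncWeight_pos ω hn)]
  exact (hP ω).trans (monotone_truncWeight ω x y hn)

lemma truncWeight_le_travelWeight (ω : Site d → ℝ≥0) (n : ℕ) (x y : Site d) :
    truncWeight ω y n x ≤ travelWeight x y ω :=
  (monotone_truncWeight ω x y).ge_of_tendsto (tendsto_truncWeight ω x y) n

lemma travelWeight_pos (ω : Site d → ℝ≥0) (x y : Site d) : 0 < travelWeight x y ω :=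
  (truncWeight_pos ω le_rfl).trans_le (truncWeight_le_travelWeight ω _ x y)

lemma travelWeight_le_one (ω : Site d → ℝ≥0) (x y : Site d) : travelWeight x y ω ≤ 1 :=
  le_of_tendsto' (tendsto_truncWeight ω x y) fun _ => truncWeight_le_one _ _ _ _

lemma travelWeight_mul_le (ω : Site d → ℝ≥0) (x y z : Site d) :
    travelWeight x y ω * travelWeight y z ω ≤ travelWeight x z ω :=
  le_of_tendsto' ((tendsto_truncWeight ω x y).mul (tendsto_truncWeight ω y z)) fun n =>
    (truncWeight_mul_le ω y z n n x).trans (truncWeight_le_travelWeight ω _ x z)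

lemma travelCost_nonneg (x y : Site d) (ω : Site d → ℝ≥0) : 0 ≤ travelCost x y ω :=
  neg_nonneg.2 (Real.log_nonpos (travelWeight_pos ω x y).le (travelWeight_le_one ω x y))

lemma travelCost_self (x : Site d) (ω : Site d → ℝ≥0) : travelCost x x ω = 0 := by
  have h : travelWeight x x ω = 1 :=
    tendsto_nhds_unique (tendsto_truncWeight ω x x) (by simp)
  rw [travelCost, h, Real.log_one, neg_zero]

lemma travelCost_triangle (x y z : Site d) (ω : Site d → ℝ≥0) :
    travelCost x z ω ≤ travelCost x y ω + travelCost y z ω := by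
  rw [travelCost, travelCost, travelCost, ← neg_add,
    ← Real.log_mul (travelWeight_pos ω x y).ne' (travelWeight_pos ω y z).ne', neg_le_neg_iff]
  exact Real.log_le_log (mul_pos (travelWeight_pos ω x y) (travelWeight_pos ω y z))
    (travelWeight_mul_le ω x y z)

lemma travelCost_le_truncCost {n : ℕ} {x y : Site d} (h : siteNorm (y - x) ≤ n)
    (ω : Site d → ℝ≥0) : travelCost x y ω ≤ truncCost n x y ω :=
  neg_le_neg (Real.log_le_log (truncWeight_pos ω h) (truncWeight_le_travelWeight ω n x y))

lemma tendsto_truncCost (x y : Site d) (ω : Site d → ℝ≥0) :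
    Tendsto (fun n => truncCost n x y ω) atTop (𝓝 (travelCost x y ω)) :=
  ((tendsto_truncWeight ω x y).log (travelWeight_pos ω x y).ne').neg

lemma measurable_travelCost (x y : Site d) : Measurable (travelCost x y) :=
  measurable_of_tendsto_metrizable (fun n => measurable_truncCost n x y)
    (tendsto_pi_nhds.2 (tendsto_truncCost x y))

lemma travelCost_add_right (x y v : Site d) (ω : Site d → ℝ≥0) :
    travelCost (x + v) (y + v) ω = travelCost x y fun z => ω (z + v) := by
  refine tendsto_nhds_unique (tendsto_truncCost (x + v) (y + v) ω) ?_
  simp only [truncCost_add_right]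
  exact tendsto_truncCost x y _

lemma travelCost_le_sum (x : Site d) (f : ℕ → Site d) (ω : Site d → ℝ≥0) (n : ℕ) :
    travelCost (f 0) x ω ≤ ∑ j ∈ Finset.range n, travelCost (f j) (f (j + 1)) ω
      + travelCost (f n) x ω := by
  induction n with
  | zero => simp
  | succ n ih =>
    rw [Finset.sum_range_succ]
    linarith [travelCost_triangle (f n) (f (n + 1)) x ω]

end Deterministic

/-! ### Stationarity and moments under the i.i.d. potential. -/

section Moments

variable {ρ : Measure ℝ≥0} [IsProbabilityMeasure ρ]

instance : IsProbabilityMeasure (potentialLaw d ρ) := by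
  unfold potentialLaw
  infer_instance

lemma measurePreserving_shift (v : Site d) :
    MeasurePreserving (fun (ω : Site d → ℝ≥0) z => ω (z + v)) (potentialLaw d ρ)
      (potentialLaw d ρ) :=
  ⟨by fun_prop, Measure.map_infinitePi_infinitePi_of_inj (P := fun _ : Site d => ρ)
    (add_left_injective v)⟩

lemma measurePreserving_eval (z : Site d) :
    MeasurePreserving (fun ω : Site d → ℝ≥0 => ω z) (potentialLaw d ρ) ρ :=
  measurePreserving_eval_infinitePi (fun _ : Site d => ρ) z

/-- The exponential moment of a single-site contribution to the cost of a path. -/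
noncomputable def siteMoment (d : ℕ) (ρ : Measure ℝ≥0) (γ : ℝ) : ℝ :=
  ∫ t : ℝ≥0, Real.exp (γ * ((t : ℝ) + Real.log (2 * d))) ∂ρ

/-- The mean of a single-site contribution to the cost of a path. -/
noncomputable def siteMean (d : ℕ) (ρ : Measure ℝ≥0) : ℝ :=
  ∫ t : ℝ≥0, ((t : ℝ) + Real.log (2 * d)) ∂ρ

variable {γ : ℝ}

omit [IsProbabilityMeasure ρ] in
lemma integrable_exp_site (hint : Integrable (fun t : ℝ≥0 => Real.exp (γ * (t : ℝ))) ρ) :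
    Integrable (fun t : ℝ≥0 => Real.exp (γ * ((t : ℝ) + Real.log (2 * d)))) ρ := by
  simp only [mul_add, Real.exp_add]
  exact hint.mul_const _

lemma integrable_exp_path (hint : Integrable (fun t : ℝ≥0 => Real.exp (γ * (t : ℝ))) ρ)
    (P : Finset (Site d)) :
    Integrable (fun ω : Site d → ℝ≥0 =>
        Real.exp (γ * ∑ z ∈ P, ((ω z : ℝ) + Real.log (2 * d)))) (potentialLaw d ρ) ∧
      ∫ ω : Site d → ℝ≥0, Real.exp (γ * ∑ z ∈ P, ((ω z : ℝ) + Real.log (2 * d)))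
        ∂(potentialLaw d ρ) = siteMoment d ρ γ ^ P.card := by
  have hind : iIndepFun (fun (z : Site d) (ω : Site d → ℝ≥0) => (ω z : ℝ) + Real.log (2 * d))
      (potentialLaw d ρ) :=
    iIndepFun_infinitePi (X := fun (_ : Site d) (t : ℝ≥0) => (t : ℝ) + Real.log (2 * d))
      fun _ => by fun_prop
  have hmeas : ∀ z : Site d, Measurable fun ω : Site d → ℝ≥0 => (ω z : ℝ) + Real.log (2 * d) :=
    fun z => by fun_prop
  constructor
  · have := hind.integrable_exp_mul_sum (t := γ) hmeas (s := P) fun z _ =>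
      (measurePreserving_eval z).integrable_comp_of_integrable (integrable_exp_site hint)
    simpa [Finset.sum_apply] using this
  · have := hind.mgf_sum (t := γ) hmeas P
    simp only [mgf, Finset.sum_apply] at this
    rw [this, Finset.prod_eq_pow_card]
    intro z _
    have hmap := (measurePreserving_eval (ρ := ρ) z).map_eq
    conv_rhs => rw [siteMoment, ← hmap]
    rw [integral_map (measurable_pi_apply z).aemeasurable (by fun_prop)]

lemma integrable_site (hγ : 0 < γ)
    (hint : Integrable (fun t : ℝ≥0 => Real.exp (γ * (t : ℝ))) ρ) :
    Integrable (fun t : ℝ≥0 => (t : ℝ) + Real.log (2 * d)) ρ := by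
  refine Integrable.add ?_ (integrable_const _)
  refine (hint.const_mul γ⁻¹).mono' (by fun_prop) (.of_forall fun t => ?_)
  rw [Real.norm_of_nonneg t.coe_nonneg, inv_mul_eq_div, le_div_iff₀ hγ, mul_comm]
  linarith [Real.add_one_le_exp (γ * (t : ℝ))]

lemma integrable_path (hγ : 0 < γ)
    (hint : Integrable (fun t : ℝ≥0 => Real.exp (γ * (t : ℝ))) ρ) (P : Finset (Site d)) :
    Integrable (fun ω : Site d → ℝ≥0 => ∑ z ∈ P, ((ω z : ℝ) + Real.log (2 * d)))
        (potentialLaw d ρ) ∧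
      ∫ ω : Site d → ℝ≥0, ∑ z ∈ P, ((ω z : ℝ) + Real.log (2 * d)) ∂(potentialLaw d ρ)
        = P.card * siteMean d ρ := by
  have h : ∀ z : Site d, Integrable (fun ω : Site d → ℝ≥0 => (ω z : ℝ) + Real.log (2 * d))
      (potentialLaw d ρ) := fun z =>
    (measurePreserving_eval z).integrable_comp_of_integrable (integrable_site hγ hint)
  refine ⟨integrable_finsetSum _ fun z _ => h z, ?_⟩
  rw [integral_finsetSum _ fun z _ => h z, ← nsmul_eq_mul]
  refine Finset.sum_eq_card_nsmul fun z _ => ?_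
  have hmap := (measurePreserving_eval (ρ := ρ) z).map_eq
  conv_rhs => rw [siteMean, ← hmap]
  rw [integral_map (measurable_pi_apply z).aemeasurable (by fun_prop)]

variable [NeZero d]

omit [IsProbabilityMeasure ρ] in
lemma siteMean_nonneg : 0 ≤ siteMean d ρ := by
  have hd : (1 : ℝ) ≤ d := by exact_mod_cast NeZero.pos d
  have := Real.log_nonneg (by linarith : (1 : ℝ) ≤ 2 * d)
  exact integral_nonneg fun t => add_nonneg t.2 this

lemma one_le_siteMoment (hγ : 0 < γ)
    (hint : Integrable (fun t : ℝ≥0 => Real.exp (γ * (t : ℝ))) ρ) : 1 ≤ siteMoment d ρ γ := by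
  have hd : (1 : ℝ) ≤ d := by exact_mod_cast NeZero.pos d
  have := Real.log_nonneg (by linarith : (1 : ℝ) ≤ 2 * d)
  calc (1 : ℝ) = ∫ _ : ℝ≥0, (1 : ℝ) ∂ρ := by simp
    _ ≤ siteMoment d ρ γ := integral_mono (integrable_const _) (integrable_exp_site hint)
        fun t => Real.one_le_exp (mul_nonneg hγ.le (add_nonneg t.2 this))

lemma integrable_travelCost (hγ : 0 < γ)
    (hint : Integrable (fun t : ℝ≥0 => Real.exp (γ * (t : ℝ))) ρ) (x y : Site d) :
    Integrable (travelCost x y) (potentialLaw d ρ) := by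
  obtain ⟨P, -, hP⟩ := exists_path_truncCost_le x y
  refine (integrable_path hγ hint P).1.mono' (measurable_travelCost x y).aestronglyMeasurable
    (.of_forall fun ω => ?_)
  rw [Real.norm_of_nonneg (travelCost_nonneg x y ω)]
  exact (travelCost_le_truncCost le_rfl ω).trans (hP _ le_rfl ω)

lemma integral_travelCost_le (hγ : 0 < γ)
    (hint : Integrable (fun t : ℝ≥0 => Real.exp (γ * (t : ℝ))) ρ) (x y : Site d) :
    ∫ ω, travelCost x y ω ∂(potentialLaw d ρ) ≤ siteNorm (y - x) * siteMean d ρ := by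
  obtain ⟨P, hcard, hP⟩ := exists_path_truncCost_le x y
  rw [← hcard, ← (integrable_path hγ hint P).2]
  exact integral_mono (integrable_travelCost hγ hint x y) (integrable_path hγ hint P).1 fun ω =>
    (travelCost_le_truncCost le_rfl ω).trans (hP _ le_rfl ω)

lemma integral_travelCost_add_right (x y v : Site d) :
    ∫ ω, travelCost (x + v) (y + v) ω ∂(potentialLaw d ρ) =
      ∫ ω, travelCost x y ω ∂(potentialLaw d ρ) := by
  simp only [travelCost_add_right]
  have h := (measurePreserving_shift (ρ := ρ) v).map_eq
  conv_rhs => rw [← h]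
  rw [integral_map (measurePreserving_shift (ρ := ρ) v).measurable.aemeasurable
    (measurable_travelCost x y).aestronglyMeasurable]

/-- The cost of travelling between two points has an exponential tail. -/
lemma measure_travelCost_ge_le (hγ : 0 < γ)
    (hint : Integrable (fun t : ℝ≥0 => Real.exp (γ * (t : ℝ))) ρ) (x y : Site d) (t : ℝ) :
    (potentialLaw d ρ).real {ω | t ≤ travelCost x y ω} ≤
      Real.exp (-γ * t) * siteMoment d ρ γ ^ siteNorm (y - x) := by
  obtain ⟨P, hcard, hP⟩ := exists_path_truncCost_le x y
  rw [← hcard, ← (integrable_exp_path hint P).2]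
  refine le_trans (measureReal_mono fun ω hω => ?_)
    (measure_ge_le_exp_mul_mgf t hγ.le (integrable_exp_path hint P).1)
  exact (le_trans hω (travelCost_le_truncCost le_rfl ω)).trans (hP _ le_rfl ω)

lemma tendsto_integral_truncCost (hγ : 0 < γ)
    (hint : Integrable (fun t : ℝ≥0 => Real.exp (γ * (t : ℝ))) ρ) (x y : Site d) :
    Tendsto (fun n => ∫ ω, truncCost n x y ω ∂(potentialLaw d ρ)) atTop
      (𝓝 (∫ ω, travelCost x y ω ∂(potentialLaw d ρ))) := by
  obtain ⟨P, -, hP⟩ := exists_path_truncCost_le x y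
  refine tendsto_integral_filter_of_dominated_convergence _
    (.of_forall fun n => (measurable_truncCost n x y).aestronglyMeasurable) ?_
    (integrable_path hγ hint P).1 (.of_forall fun ω => tendsto_truncCost x y ω)
  -- For smaller `n` no path reaches `y`: the weight is 0, and the cost is only the default value of
  -- `Real.log` at 0.
  filter_upwards [eventually_ge_atTop (siteNorm (y - x))] with n hn
  refine .of_forall fun ω => ?_
  rw [Real.norm_of_nonneg (truncCost_nonneg n x y ω)]
  exact hP n hn ω

lemma integrable_exp_truncCost
    (hint : Integrable (fun t : ℝ≥0 => Real.exp (γ * (t : ℝ))) ρ) (hγ : 0 < γ)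
    {n : ℕ} {x y : Site d} (hn : siteNorm (y - x) ≤ n) :
    Integrable (fun ω => Real.exp (γ * truncCost n x y ω)) (potentialLaw d ρ) := by
  obtain ⟨P, -, hP⟩ := exists_path_truncCost_le x y
  refine (integrable_exp_path hint P).1.mono'
    (((measurable_truncCost n x y).const_mul γ).exp).aestronglyMeasurable (.of_forall fun ω => ?_)
  rw [Real.norm_of_nonneg (Real.exp_pos _).le]
  gcongr
  exact hP n hn ω

end Moments

/-! ### The Lyapunov exponent: limit, subadditivity, scaling. -/

section Lyapunov

variable [NeZero d] {ρ : Measure ℝ≥0} [IsProbabilityMeasure ρ] {γ : ℝ}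

lemma integral_travelCost_nonneg (x y : Site d) :
    0 ≤ ∫ ω, travelCost x y ω ∂(potentialLaw d ρ) :=
  integral_nonneg fun ω => travelCost_nonneg x y ω

lemma lyapunov_nonneg (x : Site d) : 0 ≤ lyapunov d ρ x :=
  Real.iInf_nonneg fun _ => div_nonneg (integral_travelCost_nonneg _ _) (Nat.cast_nonneg _)

lemma lyapunov_le_div (x : Site d) {n : ℕ} (hn : 0 < n) :
    lyapunov d ρ x ≤ (∫ ω, travelCost 0 (n • x) ω ∂(potentialLaw d ρ)) / n :=
  ciInf_le (f := fun n : ℕ+ => (∫ ω, travelCost 0 ((n : ℕ) • x) ω ∂(potentialLaw d ρ)) / (n : ℝ))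
    ⟨0, by
      rintro _ ⟨n, rfl⟩
      exact div_nonneg (integral_travelCost_nonneg _ _) (Nat.cast_nonneg _)⟩ ⟨n, hn⟩

lemma lyapunov_le (hγ : 0 < γ)
    (hint : Integrable (fun t : ℝ≥0 => Real.exp (γ * (t : ℝ))) ρ) (x : Site d) :
    lyapunov d ρ x ≤ siteNorm x * siteMean d ρ := by
  refine (lyapunov_le_div x one_pos).trans ?_
  simpa using integral_travelCost_le hγ hint 0 x

lemma integral_travelCost_add_le (hγ : 0 < γ)
    (hint : Integrable (fun t : ℝ≥0 => Real.exp (γ * (t : ℝ))) ρ) (x y : Site d) :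
    ∫ ω, travelCost 0 (x + y) ω ∂(potentialLaw d ρ) ≤
      ∫ ω, travelCost 0 x ω ∂(potentialLaw d ρ) + ∫ ω, travelCost 0 y ω ∂(potentialLaw d ρ) := by
  rw [← integral_travelCost_add_right 0 y x, zero_add, add_comm y x,
    ← integral_add (integrable_travelCost hγ hint _ _) (integrable_travelCost hγ hint _ _)]
  exact integral_mono (integrable_travelCost hγ hint _ _)
    ((integrable_travelCost hγ hint _ _).add (integrable_travelCost hγ hint _ _))
    fun ω => travelCost_triangle _ _ _ _

lemma tendsto_lyapunov (hγ : 0 < γ)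
    (hint : Integrable (fun t : ℝ≥0 => Real.exp (γ * (t : ℝ))) ρ) (x : Site d) :
    Tendsto (fun n : ℕ => (∫ ω, travelCost 0 (n • x) ω ∂(potentialLaw d ρ)) / (n : ℝ)) atTop
      (𝓝 (lyapunov d ρ x)) := by
  have hsub : Subadditive fun n : ℕ => ∫ ω, travelCost 0 (n • x) ω ∂(potentialLaw d ρ) :=
    fun m n => by
      simp only [add_smul]
      exact integral_travelCost_add_le hγ hint _ _
  have hlim : hsub.lim = lyapunov d ρ x := by
    rw [Subadditive.lim, lyapunov, iInf]
    congr 1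
    ext t
    constructor
    · rintro ⟨n, hn, rfl⟩
      exact ⟨⟨n, hn⟩, rfl⟩
    · rintro ⟨n, rfl⟩
      exact ⟨n, n.2, rfl⟩
  rw [← hlim]
  refine hsub.tendsto_lim ⟨0, ?_⟩
  rintro _ ⟨n, rfl⟩
  exact div_nonneg (integral_travelCost_nonneg _ _) (Nat.cast_nonneg _)

lemma lyapunov_add_le (hγ : 0 < γ)
    (hint : Integrable (fun t : ℝ≥0 => Real.exp (γ * (t : ℝ))) ρ) (x y : Site d) :
    lyapunov d ρ (x + y) ≤ lyapunov d ρ x + lyapunov d ρ y := by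
  refine le_of_tendsto_of_tendsto' (tendsto_lyapunov hγ hint (x + y))
    ((tendsto_lyapunov hγ hint x).add (tendsto_lyapunov hγ hint y)) fun n => ?_
  rw [← add_div, smul_add]
  gcongr
  exact integral_travelCost_add_le hγ hint _ _

/-- The infimum for `k • x` runs only over multiples of `k` in the infimum for `x`. Homogeneity is
needed in this direction only. -/
lemma mul_lyapunov_le (k : ℕ) (x : Site d) : k * lyapunov d ρ x ≤ lyapunov d ρ (k • x) := by
  rcases Nat.eq_zero_or_pos k with rfl | hk
  · simpa using lyapunov_nonneg 0
  refine le_ciInf fun n => ?_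
  have h := lyapunov_le_div (ρ := ρ) x (Nat.mul_pos n.2 hk)
  have hk' : (0 : ℝ) < k := by exact_mod_cast hk
  have hcancel : ∀ I a b : ℝ, 0 < b → b * (I / (a * b)) = I / a := fun I a b hb => by
    rw [mul_div_assoc', mul_comm a, mul_div_mul_left _ _ hb.ne']
  rw [mul_smul, Nat.cast_mul] at h
  refine (mul_le_mul_of_nonneg_left h hk'.le).trans (hcancel _ _ _ hk').le

end Lyapunov

end RWPotential

namespace RWPotential

variable {d : ℕ} {ρ : Measure ℝ≥0} [IsProbabilityMeasure ρ]

/-! ### Independence of distant blocks and Chernoff bounds. -/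

section Independence

lemma indepFun_of_disjoint_support {f g : (Site d → ℝ≥0) → ℝ} (hf : Measurable f)
    (hg : Measurable g) {S T : Finset (Site d)} (hST : Disjoint S T)
    (hfS : ∀ ω ω', (∀ z ∈ S, ω z = ω' z) → f ω = f ω')
    (hgT : ∀ ω ω', (∀ z ∈ T, ω z = ω' z) → g ω = g ω') :
    IndepFun f g (potentialLaw d ρ) := by
  classical
  have hind : iIndepFun (fun (z : Site d) (ω : Site d → ℝ≥0) => ω z) (potentialLaw d ρ) :=
    iIndepFun_infinitePi (X := fun (_ : Site d) (t : ℝ≥0) => t) fun _ => measurable_id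
  -- Extending a configuration on `U` by zero turns a function supported on `U` into a measurable
  -- function of finitely many coordinates.
  have hext : ∀ U : Finset (Site d), Measurable fun (r : U → ℝ≥0) (z : Site d) =>
      if h : z ∈ U then r ⟨z, h⟩ else 0 := fun U => by
    refine measurable_pi_lambda _ fun z => ?_
    by_cases h : z ∈ U
    · simpa [h] using measurable_pi_apply _
    · simp [h]
  have h := (hind.indepFun_finset S T hST fun z => measurable_pi_apply z).comp
    (hf.comp (hext S)) (hg.comp (hext T))
  convert h using 1
  · funext ω
    exact hfS _ _ fun z hz => by simp [hz]
  · funext ω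
    exact hgT _ _ fun z hz => by simp [hz]

lemma integral_exp_sum_of_disjoint_support {Y : ℕ → (Site d → ℝ≥0) → ℝ} {S : ℕ → Finset (Site d)}
    {θ a : ℝ} (hY : ∀ i, Measurable (Y i))
    (hdep : ∀ i, ∀ ω ω', (∀ z ∈ S i, ω z = ω' z) → Y i ω = Y i ω')
    (hdisj : ∀ i j, i < j → Disjoint (S i) (S j))
    (hint : ∀ i, Integrable (fun ω => Real.exp (θ * Y i ω)) (potentialLaw d ρ))
    (hmgf : ∀ i, mgf (Y i) (potentialLaw d ρ) θ = a) (p : ℕ) :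
    Integrable (fun ω => Real.exp (θ * ∑ i ∈ Finset.range p, Y i ω)) (potentialLaw d ρ) ∧
      mgf (fun ω => ∑ i ∈ Finset.range p, Y i ω) (potentialLaw d ρ) θ = a ^ p := by
  classical
  induction p with
  | zero => simp
  | succ p ih =>
    have hind : IndepFun (fun ω => ∑ i ∈ Finset.range p, Y i ω) (Y p) (potentialLaw d ρ) := by
      refine indepFun_of_disjoint_support (Finset.measurable_sum _ fun i _ => hY i) (hY p)
        (S := (Finset.range p).biUnion S) (T := S p) ?_ ?_ (hdep p)
      · rw [Finset.disjoint_biUnion_left]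
        exact fun i hi => hdisj i p (Finset.mem_range.1 hi)
      · intro ω ω' h
        exact Finset.sum_congr rfl fun i hi => hdep i _ _ fun z hz =>
          h z (Finset.mem_biUnion.2 ⟨i, hi, hz⟩)
    have hadd := hind.integrable_exp_mul_add ih.1 (hint p)
    have hmul := hind.mgf_add ih.1.aestronglyMeasurable (hint p).aestronglyMeasurable
    simp only [Finset.sum_range_succ, pow_succ]
    refine ⟨hadd, ?_⟩
    rw [← ih.2, ← hmgf p, ← hmul]
    rfl

end Independence

/-- The function `θ ↦ mgf X μ θ * exp (-θ m)` equals 1 at 0 and has derivative `E[X] - m < 0` there,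
so it drops below 1 for small `θ > 0`. Since `X ≥ 0`, the moment at `γ` controls all `θ ≤ γ`, and 0
is interior to the domain. -/
lemma exists_mgf_mul_exp_lt_one {Ω : Type*} [MeasurableSpace Ω] {μ : Measure Ω}
    [IsProbabilityMeasure μ] {X : Ω → ℝ} {γ m : ℝ} (hX : Measurable X) (hX0 : ∀ ω, 0 ≤ X ω)
    (hγ : 0 < γ) (hint : Integrable (fun ω => Real.exp (γ * X ω)) μ) (hm : ∫ ω, X ω ∂μ < m) :
    ∃ θ, 0 < θ ∧ Integrable (fun ω => Real.exp (θ * X ω)) μ ∧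
      mgf X μ θ * Real.exp (-θ * m) < 1 := by
  have hsub : Set.Iic γ ⊆ integrableExpSet X μ := fun t ht => by
    refine hint.mono' (by fun_prop) (.of_forall fun ω => ?_)
    rw [Real.norm_of_nonneg (Real.exp_pos _).le]
    exact Real.exp_le_exp.2 (mul_le_mul_of_nonneg_right ht (hX0 ω))
  have h0 : (0 : ℝ) ∈ interior (integrableExpSet X μ) :=
    interior_mono hsub (by rwa [interior_Iic])
  have hderiv : HasDerivAt (fun θ => mgf X μ θ * Real.exp (-θ * m)) (∫ ω, X ω ∂μ - m) 0 := by
    have h1 := hasDerivAt_mgf h0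
    have h2 : HasDerivAt (fun θ : ℝ => Real.exp (-θ * m)) (-m) 0 := by
      have := (((hasDerivAt_id (0 : ℝ)).neg).mul_const m).exp
      simpa using this
    refine (h1.mul h2).congr_deriv ?_
    simp [sub_eq_add_neg]
  have hslope := hderiv.tendsto_slope_zero_right
  have hneg := hslope.eventually (gt_mem_nhds (sub_neg.2 hm))
  have hle : ∀ᶠ θ : ℝ in 𝓝[>] 0, θ ≤ γ :=
    mem_nhdsWithin_of_mem_nhds (Iic_mem_nhds hγ)
  obtain ⟨θ, ⟨hθ, hθγ⟩, hθ0⟩ := ((hneg.and hle).and self_mem_nhdsWithin).exists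
  refine ⟨θ, hθ0, hsub hθγ, ?_⟩
  simp only [zero_add, mgf_zero, zero_mul, neg_zero, Real.exp_zero, mul_one, smul_eq_mul] at hθ
  exact sub_neg.1 (neg_of_mul_neg_right hθ (inv_pos.2 hθ0).le)

lemma sum_range_mul_eq (f : ℕ → ℝ) (K p : ℕ) :
    ∑ j ∈ Finset.range (K * p), f j =
      ∑ r ∈ Finset.range K, ∑ i ∈ Finset.range p, f (r + K * i) := by
  induction p with
  | zero => simp
  | succ p ih =>
    simp only [Finset.sum_range_succ, Finset.sum_add_distrib, ← ih]
    rw [mul_add, mul_one, Finset.sum_range_add]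
    simp only [add_comm]

/-- Within one residue class mod `K` the starting points are at least `K > 2n` apart, so the balls
of radius `n` are disjoint and the block costs are i.i.d. -/
lemma measure_sum_truncCost_ge_le {θ : ℝ} (hθ : 0 ≤ θ) {n N K : ℕ} {v : Site d} (hv : v ≠ 0)
    (hN : 0 < N) (hK : 2 * n < K)
    (hint : Integrable (fun ω => Real.exp (θ * truncCost n 0 (N • v) ω)) (potentialLaw d ρ))
    (m : ℝ) (r p : ℕ) :
    (potentialLaw d ρ).real {ω | p * m ≤ ∑ i ∈ Finset.range p,
        truncCost n (((r + K * i) * N) • v) (((r + K * i + 1) * N) • v) ω} ≤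
      (mgf (truncCost n 0 (N • v)) (potentialLaw d ρ) θ * Real.exp (-θ * m)) ^ p := by
  have hshift : ∀ j : ℕ, truncCost n ((j * N) • v) (((j + 1) * N) • v) =
      truncCost n 0 (N • v) ∘ fun ω z => ω (z + (j * N) • v) := fun j => by
    funext ω
    rw [Function.comp_apply, ← truncCost_add_right, zero_add, ← add_smul]
    congr 2
    ring
  have hv' : 0 < siteNorm v := Nat.pos_of_ne_zero fun h => hv (siteNorm_eq_zero.1 h)
  have hfin : ∀ x : Site d, {z : Site d | siteNorm (z - x) ≤ n}.Finite := fun x =>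
    ((finite_siteNorm_le n).image (· + x)).subset fun z hz => ⟨z - x, hz, sub_add_cancel z x⟩
  obtain ⟨h1, h2⟩ := integral_exp_sum_of_disjoint_support (ρ := ρ) (θ := θ)
    (a := mgf (truncCost n 0 (N • v)) (potentialLaw d ρ) θ)
    (Y := fun i => truncCost n (((r + K * i) * N) • v) (((r + K * i + 1) * N) • v))
    (S := fun i => (hfin (((r + K * i) * N) • v)).toFinset)
    (fun i => measurable_truncCost _ _ _)
    (fun i ω ω' h => truncCost_congr _ _ _ fun z hz => h z (by simpa using hz))
    (fun i j hij => by
      rw [Finset.disjoint_left]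
      intro z hz hz'
      simp only [Set.Finite.mem_toFinset, Set.mem_ofPred_eq] at hz hz'
      obtain ⟨e, rfl⟩ := Nat.exists_eq_add_of_lt hij
      have htri := siteNorm_add_le (z - ((r + K * i) * N) • v)
        (-(z - ((r + K * (i + e + 1)) * N) • v))
      have hdiff : z - ((r + K * i) * N) • v + -(z - ((r + K * (i + e + 1)) * N) • v) =
          (K * (e + 1) * N) • v := by
        rw [show (r + K * (i + e + 1)) * N = (r + K * i) * N + K * (e + 1) * N by ring, add_smul]
        abel
      rw [hdiff, siteNorm_nsmul, siteNorm_neg] at htri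
      have hle : K ≤ K * (e + 1) * N * siteNorm v := by
        rw [mul_assoc, mul_assoc]
        exact Nat.le_mul_of_pos_right K (by positivity)
      omega)
    (fun i => by
      simp only [hshift]
      exact (measurePreserving_shift _).integrable_comp_of_integrable hint)
    (fun i => by
      simp only [hshift]
      have h := (measurePreserving_shift (ρ := ρ) (((r + K * i) * N) • v)).map_eq
      conv_rhs => rw [← h]
      refine (mgf_map (measurePreserving_shift (ρ := ρ) _).measurable.aemeasurable ?_).symm
      rw [h]
      exact hint.aestronglyMeasurable)
    p
  refine (measure_ge_le_exp_mul_mgf _ hθ h1).trans (le_of_eq ?_)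
  rw [h2, mul_pow, ← Real.exp_nat_mul, mul_comm]
  congr 2
  ring

/-! ### Tail bound in a fixed direction. -/

variable [NeZero d] {γ : ℝ}

/-- Exponential upper tail bound along a fixed lattice direction. -/
lemma exists_measure_travelCost_nsmul_le (hγ : 0 < γ)
    (hint : Integrable (fun t : ℝ≥0 => Real.exp (γ * (t : ℝ))) ρ) (v : Site d) {ε : ℝ}
    (hε : 0 < ε) :
    ∃ C c : ℝ, 0 < C ∧ 0 < c ∧ ∀ k : ℕ, (potentialLaw d ρ).real
      {ω | k * (lyapunov d ρ v + ε) ≤ travelCost 0 (k • v) ω} ≤ C * Real.exp (-c * k) := by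
  have hα := lyapunov_nonneg (ρ := ρ) v
  by_cases hv : v = 0
  · refine ⟨1, 1, one_pos, one_pos, fun k => ?_⟩
    rcases Nat.eq_zero_or_pos k with rfl | hk
    · simp
    · have hk' : (0 : ℝ) < k := by exact_mod_cast hk
      have : {ω | k * (lyapunov d ρ v + ε) ≤ travelCost 0 (k • v) ω} = ∅ := by
        refine Set.eq_empty_of_forall_notMem fun ω hω => ?_
        rw [Set.mem_ofPred_eq, hv, smul_zero, travelCost_self, ← hv] at hω
        have : 0 < k * (lyapunov d ρ v + ε) := by positivity
        linarith
      rw [this]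
      simp [Real.exp_nonneg]
  obtain ⟨N, hNlt⟩ := exists_lt_of_ciInf_lt (show lyapunov d ρ v < lyapunov d ρ v + ε / 2 by
    linarith)
  obtain ⟨N, hN⟩ := N
  have hN' : (0 : ℝ) < N := by exact_mod_cast hN
  have hmean : ∫ ω, travelCost 0 (N • v) ω ∂(potentialLaw d ρ) <
      N * (lyapunov d ρ v + ε / 2) := by
    rw [mul_comm]
    exact (div_lt_iff₀ hN').1 hNlt
  obtain ⟨n, hn, hnN⟩ := (((tendsto_integral_truncCost hγ hint 0 (N • v)).eventually
    (gt_mem_nhds hmean)).and (eventually_ge_atTop (siteNorm (N • v - 0)))).exists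
  obtain ⟨θ, hθ, hθint, hq⟩ := exists_mgf_mul_exp_lt_one (measurable_truncCost n 0 (N • v))
    (truncCost_nonneg n 0 (N • v)) hγ (integrable_exp_truncCost hint hγ hnN) hn
  set m : ℝ := N * (lyapunov d ρ v + ε / 2) with hm
  set q : ℝ := mgf (truncCost n 0 (N • v)) (potentialLaw d ρ) θ * Real.exp (-θ * m) with hqdef
  have hq0 : 0 < q := mul_pos (mgf_pos hθint) (Real.exp_pos _)
  set K : ℕ := 2 * n + 1 with hK
  set L : ℕ := K * N with hL
  have hL0 : 0 < L := by positivity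
  have hL' : (0 : ℝ) < L := by exact_mod_cast hL0
  set b : ℝ := -Real.log q with hb
  have hb0 : 0 < b := neg_pos.2 (Real.log_neg hq0 hq)
  set B : ℝ := siteMoment d ρ γ with hB
  have hB1 : 1 ≤ B := one_le_siteMoment hγ hint
  -- Each of the `K` classes contributes `q ^ p`, where `q = exp (-b)` and `p ≥ k / L - 1`. The
  -- second term bounds the moment of the remaining stretch `(k % L) • v`.
  refine ⟨K * Real.exp b + B ^ (L * siteNorm v), min (b / L) (γ * (ε / 2)), by positivity,
    by positivity, fun k => ?_⟩
  set p : ℕ := k / L with hp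
  have hkdecomp : L * p + k % L = k := Nat.div_add_mod k L
  -- If every class sum is below `p m`, the `K p` blocks cost at most `L p (α(v) + ε/2) ≤ k (α(v) +
  -- ε/2)`. Reaching the level `k (α(v) + ε)` then requires `k ε/2` from the remainder.
  have hsub : {ω | k * (lyapunov d ρ v + ε) ≤ travelCost 0 (k • v) ω} ⊆
      (⋃ r ∈ Finset.range K, {ω | p * m ≤ ∑ i ∈ Finset.range p,
        truncCost n (((r + K * i) * N) • v) (((r + K * i + 1) * N) • v) ω}) ∪
      {ω | k * (ε / 2) ≤ travelCost ((L * p) • v) (k • v) ω} := by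
    intro ω hω
    by_contra hcon
    simp only [Set.mem_union, Set.mem_iUnion, Set.mem_ofPred_eq, not_or, not_exists, not_le] at hcon hω
    obtain ⟨hcon1, hcon2⟩ := hcon
    have hsum := travelCost_le_sum (k • v) (fun j => (j * N) • v) ω (K * p)
    have hle : ∑ j ∈ Finset.range (K * p), travelCost ((j * N) • v) (((j + 1) * N) • v) ω ≤
        K * (p * m) := by
      calc _ ≤ ∑ j ∈ Finset.range (K * p), truncCost n ((j * N) • v) (((j + 1) * N) • v) ω := by
            refine Finset.sum_le_sum fun j _ => travelCost_le_truncCost ?_ ω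
            rwa [add_mul, one_mul, add_smul, add_sub_cancel_left, ← sub_zero (N • v)]
        _ = _ := sum_range_mul_eq _ _ _
        _ ≤ ∑ r ∈ Finset.range K, p * m := Finset.sum_le_sum fun r hr => (hcon1 r hr).le
        _ = K * (p * m) := by simp
    have hKpN : K * p * N = L * p := by rw [hL]; ring
    simp only [zero_mul, zero_smul, hKpN] at hsum
    have hkL : (L : ℝ) * p ≤ k := by exact_mod_cast (by omega : L * p ≤ k)
    have hcalc : (K : ℝ) * (p * m) = L * p * (lyapunov d ρ v + ε / 2) := by
      rw [hm, hL]
      push_cast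
      ring
    have := mul_le_mul_of_nonneg_right hkL (by linarith : 0 ≤ lyapunov d ρ v + ε / 2)
    linarith
  have hblock : ∀ r ∈ Finset.range K, (potentialLaw d ρ).real {ω | p * m ≤ ∑ i ∈ Finset.range p,
      truncCost n (((r + K * i) * N) • v) (((r + K * i + 1) * N) • v) ω} ≤ q ^ p := fun r _ =>
    measure_sum_truncCost_ge_le hθ.le hv hN (by omega) hθint m r p
  have hrem : (potentialLaw d ρ).real {ω | k * (ε / 2) ≤ travelCost ((L * p) • v) (k • v) ω} ≤
      Real.exp (-γ * (k * (ε / 2))) * B ^ (L * siteNorm v) := by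
    refine (measure_travelCost_ge_le hγ hint _ _ _).trans ?_
    have hkv : k • v - (L * p) • v = (k % L) • v := by
      conv_lhs => rw [← hkdecomp, add_smul, add_sub_cancel_left]
    rw [hkv, siteNorm_nsmul]
    gcongr
    exact (Nat.mod_lt k hL0).le
  have hqp : q ^ p ≤ Real.exp b * Real.exp (-(b / L) * k) := by
    have hpk : (k : ℝ) / L ≤ p + 1 := by
      rw [div_le_iff₀ hL']
      have hlt := Nat.mod_lt k hL0
      have hle : k ≤ (p + 1) * L := by
        rw [add_mul, one_mul, mul_comm p]
        omega
      exact_mod_cast hle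
    rw [← Real.exp_log hq0, ← Real.exp_nat_mul, ← Real.exp_add, Real.exp_le_exp]
    have h1 : -(b / L) * k = -b * (k / L) := by ring
    have h2 : Real.log q = -b := by rw [hb, neg_neg]
    rw [h1, h2]
    nlinarith
  have hc1 : Real.exp (-(b / L) * k) ≤ Real.exp (-min (b / L) (γ * (ε / 2)) * k) := by
    gcongr
    exact min_le_left _ _
  have hc2 : Real.exp (-γ * (k * (ε / 2))) ≤ Real.exp (-min (b / L) (γ * (ε / 2)) * k) := by
    rw [show -γ * (k * (ε / 2)) = -(γ * (ε / 2)) * k by ring]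
    gcongr
    exact min_le_right _ _
  calc _ ≤ _ := measureReal_mono hsub
    _ ≤ _ := measureReal_union_le _ _
    _ ≤ ∑ r ∈ Finset.range K, q ^ p + Real.exp (-γ * (k * (ε / 2))) * B ^ (L * siteNorm v) :=
        add_le_add ((measureReal_biUnion_finset_le _ _).trans (Finset.sum_le_sum hblock)) hrem
    _ = K * q ^ p + Real.exp (-γ * (k * (ε / 2))) * B ^ (L * siteNorm v) := by simp
    _ ≤ K * (Real.exp b * Real.exp (-min (b / L) (γ * (ε / 2)) * k)) +
        Real.exp (-min (b / L) (γ * (ε / 2)) * k) * B ^ (L * siteNorm v) := by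
        gcongr
        exact hqp.trans (by gcongr)
    _ = _ := by ring

end RWPotential

namespace RWPotential

/-! ### Uniformity over all lattice points. -/

lemma exists_uniform_exponential_bound {α : Type*} {F : α → ℕ → ℝ} (V : Finset α)
    (h : ∀ v, ∃ C c : ℝ, 0 < C ∧ 0 < c ∧ ∀ k : ℕ, F v k ≤ C * Real.exp (-c * k)) :
    ∃ C c : ℝ, 0 < C ∧ 0 < c ∧ ∀ v ∈ V, ∀ k : ℕ, F v k ≤ C * Real.exp (-c * k) := by
  classical
  induction V using Finset.induction_on with
  | empty => exact ⟨1, 1, one_pos, one_pos, by simp⟩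
  | insert a V _ ih =>
    obtain ⟨C, c, hC, hc, hV⟩ := ih
    obtain ⟨C', c', hC', hc', ha⟩ := h a
    refine ⟨max C C', min c c', by positivity, by positivity, fun v hv k => ?_⟩
    rcases Finset.mem_insert.1 hv with rfl | hv
    · refine (ha k).trans ?_
      gcongr
      · exact le_max_right _ _
      · exact min_le_right _ _
    · refine (hV v hv k).trans ?_
      gcongr
      · exact le_max_left _ _
      · exact min_le_left _ _

variable {d : ℕ}

/-- Every lattice point is close to a large multiple of a lattice point of bounded norm. -/
lemma exists_nsmul_near {M k : ℕ} (hk : 0 < k) {x : Site d} (hx : siteNorm x ≤ 2 * M * k) :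
    ∃ v : Site d, siteNorm v ≤ d * (2 * M) ∧ siteNorm (x - k • v) ≤ d * k := by
  have hk' : (0 : ℤ) < k := by exact_mod_cast hk
  -- Floor division in each coordinate leaves remainders in `[0, k)`.
  refine ⟨fun i => x i / k, ?_, ?_⟩
  · refine (Finset.sum_le_card_nsmul _ _ (2 * M) fun i _ => ?_).trans (by simp)
    have hi : (x i).natAbs ≤ 2 * M * k := (natAbs_le_siteNorm x i).trans hx
    have hi' : |x i| ≤ 2 * M * k := by
      rw [Int.abs_eq_natAbs]
      exact_mod_cast hi
    obtain ⟨h1, h2⟩ := abs_le.1 hi'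
    have h3 : -(2 * M : ℤ) ≤ x i / k := Int.le_ediv_of_mul_le hk' (by linarith)
    have h4 : x i / k ≤ 2 * M := Int.ediv_le_of_le_mul hk' h2
    change (x i / k : ℤ).natAbs ≤ 2 * M
    omega
  · refine (Finset.sum_le_card_nsmul _ _ k fun i _ => ?_).trans (by simp)
    have h1 : (x - k • fun i => x i / (k : ℤ)) i = x i % k := by
      rw [Pi.sub_apply, Pi.smul_apply, nsmul_eq_mul, Int.emod_def]
    rw [h1]
    have h2 := Int.emod_nonneg (x i) hk'.ne'
    have h3 := Int.emod_lt_of_pos (x i) hk'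
    omega

/-- Exponential upper tail bound, uniformly over all lattice directions. -/
lemma exists_measure_travelCost_sub_lyapunov_le [NeZero d] {ρ : Measure ℝ≥0}
    [IsProbabilityMeasure ρ] {γ : ℝ} (hγ : 0 < γ)
    (hint : Integrable (fun t : ℝ≥0 => Real.exp (γ * (t : ℝ))) ρ) {ε : ℝ} (hε : 0 < ε) :
    ∃ C c : ℝ, 0 < C ∧ 0 < c ∧ ∀ x : Site d, (potentialLaw d ρ).real
      {ω | ε * l1norm x ≤ travelCost 0 x ω - lyapunov d ρ x} ≤ C * Real.exp (-c * l1norm x) := by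
  set A : ℝ := siteMean d ρ with hA
  set B : ℝ := siteMoment d ρ γ with hB
  have hA0 : 0 ≤ A := siteMean_nonneg
  have hB1 : 1 ≤ B := one_le_siteMoment hγ hint
  have hlogB : 0 ≤ Real.log B := Real.log_nonneg hB1
  -- The two lower bounds on `M` make the leftover stretch, of length at most `d k`, harmless: the
  -- first in the comparison of `α(v)` with `α(x)`, the second in its exponential moment.
  obtain ⟨M, hM⟩ := exists_nat_gt (max (d * A / (ε / 4)) (d * Real.log B / (γ * ε / 4)))
  have hM1 : d * A ≤ ε / 4 * M := by
    rw [mul_comm (ε / 4), ← div_le_iff₀ (by positivity)]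
    exact ((le_max_left _ _).trans_lt hM).le
  have hM2 : d * Real.log B ≤ γ * ε / 4 * M := by
    rw [mul_comm (γ * ε / 4), ← div_le_iff₀ (by positivity)]
    exact ((le_max_right _ _).trans_lt hM).le
  have hM0' : (0 : ℝ) < M := lt_of_le_of_lt (le_max_of_le_left (by positivity)) hM
  have hM0 : 0 < M := by exact_mod_cast hM0'
  obtain ⟨C, c, hC, hc, hV⟩ := exists_uniform_exponential_bound
    (finite_siteNorm_le (d := d) (d * (2 * M))).toFinset fun v =>
      exists_measure_travelCost_nsmul_le hγ hint v (by positivity : 0 < ε / 4)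
  set c' : ℝ := min (c / (2 * M)) (γ * ε / 4) with hc'
  have hc'0 : 0 < c' := by positivity
  -- The factor `exp (c' M)` makes the bound trivial when `‖x‖₁ < M`, where `k` would be 0.
  refine ⟨(C + 1) * Real.exp (c' * M), c', by positivity, hc'0, fun x => ?_⟩
  rw [l1norm_eq_siteNorm]
  set l : ℕ := siteNorm x with hl
  have hexpM : 1 ≤ Real.exp (c' * M) := Real.one_le_exp (by positivity)
  rcases lt_or_ge l M with hlM | hlM
  · refine measureReal_le_one.trans ?_
    rw [mul_assoc, ← Real.exp_add]
    have hlM' : (l : ℝ) ≤ M := by exact_mod_cast hlM.le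
    have : 1 ≤ Real.exp (c' * M + -c' * l) := Real.one_le_exp (by nlinarith)
    nlinarith
  set k : ℕ := l / M with hk
  have hk0 : 0 < k := Nat.div_pos hlM hM0
  have hkM : k * M ≤ l := Nat.div_mul_le_self l M
  have hlk : l ≤ 2 * M * k := by
    have h1 : l < (k + 1) * M := (Nat.div_lt_iff_lt_mul hM0).1 (Nat.lt_succ_self _)
    nlinarith
  have hkM' : (k : ℝ) * M ≤ l := by exact_mod_cast hkM
  have hlk' : (l : ℝ) ≤ 2 * M * k := by exact_mod_cast hlk
  have hkl : (k : ℝ) ≤ l := by exact_mod_cast Nat.div_le_self l M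
  obtain ⟨v, hv, hvx⟩ := exists_nsmul_near hk0 hlk
  have hvx' : (siteNorm (x - k • v) : ℝ) ≤ d * k := by exact_mod_cast hvx
  have hα : k * lyapunov d ρ v ≤ lyapunov d ρ x + ε / 4 * l := by
    have h1 := lyapunov_add_le hγ hint x (-(x - k • v))
    have h2 := lyapunov_le hγ hint (-(x - k • v))
    rw [siteNorm_neg] at h2
    rw [neg_sub, add_sub_cancel] at h1
    rw [neg_sub] at h2
    have h3 := mul_lyapunov_le (ρ := ρ) k v
    have h4 := mul_le_mul_of_nonneg_right hvx' hA0
    have h5 := mul_le_mul_of_nonneg_left hM1 (Nat.cast_nonneg (α := ℝ) k)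
    have h6 := mul_le_mul_of_nonneg_left hkM' (by positivity : 0 ≤ ε / 4)
    nlinarith
  -- The budget `ε l` is spent as `ε/4` on `k α(v)` against `α(x)`, `ε/4` on the deviation along `v`
  -- (as `k ≤ l`), and `ε/2` on the stretch from `k • v` to `x`.
  have hsub : {ω | ε * l ≤ travelCost 0 x ω - lyapunov d ρ x} ⊆
      {ω | k * (lyapunov d ρ v + ε / 4) ≤ travelCost 0 (k • v) ω} ∪
      {ω | ε / 2 * l ≤ travelCost (k • v) x ω} := by
    intro ω hω
    by_contra hcon
    simp only [Set.mem_union, Set.mem_ofPred_eq, not_or, not_le] at hcon hω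
    have h1 := travelCost_triangle 0 (k • v) x ω
    nlinarith [hcon.1, hcon.2]
  have h1 := hV v (by simpa using hv) k
  have h2 : (potentialLaw d ρ).real {ω | ε / 2 * l ≤ travelCost (k • v) x ω} ≤
      Real.exp (-(γ * ε / 4) * l) := by
    refine (measure_travelCost_ge_le hγ hint _ _ _).trans ?_
    rw [← hB, ← Real.exp_log (by positivity : 0 < B), ← Real.exp_nat_mul, ← Real.exp_add,
      Real.exp_le_exp]
    have h4 := mul_le_mul_of_nonneg_right hvx' hlogB
    have h5 := mul_le_mul_of_nonneg_left hM2 (Nat.cast_nonneg (α := ℝ) k)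
    have h6 := mul_le_mul_of_nonneg_left hkM' (by positivity : 0 ≤ γ * ε / 4)
    nlinarith
  have h3 : Real.exp (-c * k) ≤ Real.exp (-c' * l) := by
    rw [Real.exp_le_exp, neg_mul, neg_mul, neg_le_neg_iff]
    calc c' * l ≤ c / (2 * M) * (2 * M * k) := by
          gcongr
          exact min_le_left _ _
      _ = c * k := by field_simp
  have h4 : Real.exp (-(γ * ε / 4) * l) ≤ Real.exp (-c' * l) := by
    gcongr
    exact min_le_right _ _
  calc _ ≤ _ := measureReal_mono hsub
    _ ≤ _ := measureReal_union_le _ _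
    _ ≤ C * Real.exp (-c' * l) + Real.exp (-c' * l) := by
        refine add_le_add (h1.trans ?_) (h2.trans h4)
        gcongr
    _ = (C + 1) * 1 * Real.exp (-c' * l) := by ring
    _ ≤ _ := by gcongr

end RWPotential

theorem theorem2p1 (d : ℕ) [NeZero d] (hd : 2 ≤ d)
    (ρ : MeasureTheory.Measure ℝ≥0) [MeasureTheory.IsProbabilityMeasure ρ]
    (hρ : ¬ ∀ᵐ t ∂ρ, t = 0)
    (hA1 : ∃ γ : ℝ, 0 < γ ∧ MeasureTheory.Integrable (fun t : ℝ≥0 => Real.exp (γ * (t : ℝ))) ρ) :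
    (∀ x : RWPotential.Site d,
      (∀ n : ℕ, MeasureTheory.Integrable (RWPotential.travelCost 0 (n • x))
        (RWPotential.potentialLaw d ρ)) ∧
      Filter.Tendsto
        (fun n : ℕ =>
          (∫ ω, RWPotential.travelCost 0 (n • x) ω ∂(RWPotential.potentialLaw d ρ)) / (n : ℝ))
        Filter.atTop (nhds (RWPotential.lyapunov d ρ x))) ∧
    ∀ ε : ℝ, 0 < ε → ∃ C c : ℝ, 0 < C ∧ 0 < c ∧ ∀ x : RWPotential.Site d,
      (RWPotential.potentialLaw d ρ).real
          {ω | ε * RWPotential.l1norm x ≤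
            RWPotential.travelCost 0 x ω - RWPotential.lyapunov d ρ x}
        ≤ C * Real.exp (-c * RWPotential.l1norm x) := by
  obtain ⟨γ, hγ, hint⟩ := hA1
  exact ⟨fun x => ⟨fun n => RWPotential.integrable_travelCost hγ hint 0 (n • x),
    RWPotential.tendsto_lyapunov hγ hint x⟩, fun ε hε =>
    RWPotential.exists_measure_travelCost_sub_lyapunov_le hγ hint hε⟩
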